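/- A signed graph $\Gamma=(G,\sigma)$ is a finite simple graph $G$ with a signature $\sigma:E(G)\to\{-1,1\}$; its adjacency matrix has $(u,v)$-entry $\sigma(uv)$ if $uv\in E(G)$ and $0$ otherwise, and its spectral radius $\rho(\Gamma)$ is the largest absolute value of an eigenvalue of this matrix. A cycle of $\Gamma$ is negative if it has an odd number of negative edges, and $\Gamma$ is unbalanced if it contains a negative cycle. Switching in a set $U$ of vertices reverses the signs of all edges with exactly one end in $U$; two signed graphs are switching isomorphic if one is isomorphic (by a sign-preserving graph isomorphism) to a signed graph obtained from the other by switching in some vertex set. An $r$ by $s$ bipartite graph is a graph whose vertex set is the disjoint union of sets $X$ and $Y$ with $|X|=r$ and $|Y|=s$ such that every edge joins a vertex of $X$ and a vertex of $Y$. For integers $3\le r\le s$, let $\Gamma_{r,s}$ be the signed graph obtained from the complete bipartite graph $K_{r-1,s-1}$ by deleting an edge $uv$ and adding a path of length three (with two new inner vertices) from $u$ to $v$, where the central edge of this path is negative and all other edges are positive. **Theorem.** Let $3\le r\le s$ be integers and let $\Gamma$ be an unbalanced signed graph whose underlying graph is an $r$ by $s$ bipartite graph (not necessarily connected) and which contains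 no negative cycle of length $4$. Then \[ \rho(\Gamma)\le \sqrt{\frac12\left((r-1)(s-1)+2+\sqrt{\bigl((r-1)(s-1)+2\bigr)^2-4(2r-3)(2s-3)}\right)}, \] and equality holds if and only if $\Gamma$ is switching isomorphic to $\Gamma_{r,s}$. -/

import Mathlib

/-- A signed graph `(G, σ)` on the vertex set `V`: a simple graph together with a signature
`σ : E(G) → {-1, 1}`. -/
structure SignedGraph (V : Type*) where
  /-- the underlying graph -/
  graph : SimpleGraph V
  /-- the signature -/
  sign : graph.edgeSet → ℤˣ

namespace SignedGraph

variable {V W : Type*}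

open Classical in
/-- The adjacency matrix: the `(u, v)` entry is the sign of the edge `uv`, and `0` if there is no
such edge. -/
noncomputable def adjMatrix (Γ : SignedGraph V) : Matrix V V ℝ :=
  Matrix.of fun u v =>
    if h : Γ.graph.Adj u v then ((Γ.sign ⟨s(u, v), h⟩ : ℤ) : ℝ) else 0

/-- The spectral radius `ρ(Γ)`: the largest absolute value of an eigenvalue of the adjacency
matrix (which is real symmetric, so that all its eigenvalues are real). -/
noncomputable def rho [Fintype V] [DecidableEq V] (Γ : SignedGraph V) : ℝ :=
  (spectralRadius ℝ Γ.adjMatrix).toReal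

/-- `e` is a negative edge of `Γ`. -/
def IsNegativeEdge (Γ : SignedGraph V) (e : Sym2 V) : Prop :=
  ∃ h : e ∈ Γ.graph.edgeSet, Γ.sign ⟨e, h⟩ = -1

open Classical in
/-- The closed walk `c` is a negative cycle of `Γ`: it is a cycle with an odd number of negative
edges. -/
def IsNegativeCycle (Γ : SignedGraph V) {v : V} (c : Γ.graph.Walk v v) : Prop :=
  c.IsCycle ∧ Odd (c.edges.countP fun e => decide (Γ.IsNegativeEdge e))

/-- `Γ` is unbalanced: it contains at least one negative cycle. -/
def IsUnbalanced (Γ : SignedGraph V) : Prop :=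
  ∃ (v : V) (c : Γ.graph.Walk v v), Γ.IsNegativeCycle c

/-- `Γ` contains a negative cycle of length four. -/
def HasNegativeC4 (Γ : SignedGraph V) : Prop :=
  ∃ (v : V) (c : Γ.graph.Walk v v), c.length = 4 ∧ Γ.IsNegativeCycle c

/-- The underlying graph of `Γ` is an `r` by `s` bipartite graph: its vertex set is the union of
disjoint sets `X` and `Y` of sizes `r` and `s` such that every edge joins `X` to `Y`. -/
def IsBipartiteOfSizes (Γ : SignedGraph V) (r s : ℕ) : Prop :=
  ∃ X Y : Set V, X ∪ Y = Set.univ ∧ Γ.graph.IsBipartiteWith X Y ∧ X.encard = r ∧ Y.encard = s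

open Classical in
/-- Switching in `U` reverses the signs of all edges between a vertex in `U` and a vertex
outside `U`. -/
noncomputable def switch (Γ : SignedGraph V) (U : Set V) : SignedGraph V where
  graph := Γ.graph
  sign e := if ∃ u v, u ∈ U ∧ v ∉ U ∧ (e : Sym2 V) = s(u, v) then -Γ.sign e else Γ.sign e

/-- `Γ` and `Δ` are switching equivalent. -/
def SwitchingEquivalent (Γ Δ : SignedGraph V) : Prop :=
  ∃ U : Set V, Δ = Γ.switch U

/-- `Γ` and `Δ` are isomorphic: some isomorphism of the underlying graphs preserves the signs of
the edges. -/
def Isomorphic (Γ : SignedGraph V) (Δ : SignedGraph W) : Prop :=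
  ∃ φ : Γ.graph ≃g Δ.graph, ∀ e : Γ.graph.edgeSet, Δ.sign (φ.mapEdgeSet e) = Γ.sign e

/-- `Γ` and `Δ` are switching isomorphic: `Δ` is isomorphic to a signed graph that is switching
equivalent to `Γ`. -/
def SwitchingIsomorphic (Γ : SignedGraph V) (Δ : SignedGraph W) : Prop :=
  ∃ Γ' : SignedGraph V, Γ.SwitchingEquivalent Γ' ∧ Δ.Isomorphic Γ'

/-- The underlying graph of `Γ_{r,s}`, on `x₀, …, x_{r-1}` and `y₀, …, y_{s-1}`. The vertices with
positive index form a complete bipartite graph `K_{r-1,s-1}`, from which the edge `x₁y₁` is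
deleted and to which the path `y₁ x₀ y₀ x₁` of length three is added. -/
def gammaGraph (r s : ℕ) : SimpleGraph (Fin r ⊕ Fin s) :=
  SimpleGraph.fromRel fun a b => ∃ (i : Fin r) (j : Fin s), a = Sum.inl i ∧ b = Sum.inr j ∧
    ((1 ≤ i.val ∧ 1 ≤ j.val ∧ ¬ (i.val = 1 ∧ j.val = 1)) ∨
      (i.val = 0 ∧ j.val = 1) ∨ (i.val = 0 ∧ j.val = 0) ∨ (i.val = 1 ∧ j.val = 0))

open Classical in
/-- The signed graph `Γ_{r,s}`: the central edge `x₀y₀` of the added path is its only negative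
edge. -/
noncomputable def gamma (r s : ℕ) : SignedGraph (Fin r ⊕ Fin s) where
  graph := gammaGraph r s
  sign e := if ∃ (i : Fin r) (j : Fin s), i.val = 0 ∧ j.val = 0 ∧
    (e : Sym2 (Fin r ⊕ Fin s)) = s(Sum.inl i, Sum.inr j) then -1 else 1

end SignedGraph

/-! Since the graph is bipartite, ρ = ρ(Γ) is itself an eigenvalue; switch so that an eigenvector x
for it is nonnegative. As Γ is unbalanced, some edge uv is still negative. Sort the vertices into u,
v, the positive neighbours of v, those of u, and the rest of each side. An edge of sign 1 between
the two neighbour classes would close a negative 4-cycle, so the adjacency matrix is entrywise at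
most a blow-up of the 6 × 6 pattern `blockMatrix`. As x ≥ 0, Rayleigh quotients bound ρ by the
largest eigenvalue μ of the blow-up. All six classes are nonempty: the switching can be chosen so
that u and v have positive neighbours (`exists_switch`), and no vertex is joined to the whole other
side (`exists_eq_zero`).

Let a, b be the numbers of positive neighbours of v, u, and d, c those of the remaining vertices, so
that r = 1 + a + d and s = 1 + b + c. Then μ² is a root of an explicit quadratic (`charpoly_eq`). At
μ² the quadratic t² - ((r-1)(s-1)+2)t + (2r-3)(2s-3) is minus a sum of nonnegative terms built from
a-1, b-1, c-1, d-1, so μ² is at most its larger root (`IsBlockEigen.sq_le`).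

In case of equality these terms vanish and x is a nonnegative eigenvector of the blow-up. This
forces a = b = 1 (`eq_one_of_sq_eq`) and x > 0 outside u and v, so the switched Γ is the whole
blow-up, which is Γ_{r,s}. Conversely, solving the block equations shows that Γ_{r,s} attains the
bound. -/

namespace SignedGraph

/-! ### Signs, balance and switching read off the adjacency matrix -/

section Basic

variable {V : Type*} (Γ : SignedGraph V)

theorem adjMatrix_of_adj {u v : V} (h : Γ.graph.Adj u v) :
    Γ.adjMatrix u v = ((Γ.sign ⟨s(u, v), h⟩ : ℤ) : ℝ) := by
  simp [adjMatrix, h]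

theorem adjMatrix_of_not_adj {u v : V} (h : ¬ Γ.graph.Adj u v) : Γ.adjMatrix u v = 0 := by
  simp [adjMatrix, h]

theorem adjMatrix_comm (u v : V) : Γ.adjMatrix u v = Γ.adjMatrix v u := by
  by_cases h : Γ.graph.Adj u v
  · rw [Γ.adjMatrix_of_adj h, Γ.adjMatrix_of_adj h.symm]
    simp only [Sym2.eq_swap]
  · rw [Γ.adjMatrix_of_not_adj h, Γ.adjMatrix_of_not_adj fun h' => h h'.symm]

theorem isHermitian_adjMatrix : Γ.adjMatrix.IsHermitian := by
  ext u v
  simp [Γ.adjMatrix_comm u v]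

theorem adjMatrix_eq_one_or_neg_one {u v : V} (h : Γ.graph.Adj u v) :
    Γ.adjMatrix u v = 1 ∨ Γ.adjMatrix u v = -1 := by
  rw [Γ.adjMatrix_of_adj h]
  rcases Int.units_eq_one_or (Γ.sign ⟨s(u, v), h⟩) with h | h <;> simp [h]

theorem adjMatrix_ne_zero_iff {u v : V} : Γ.adjMatrix u v ≠ 0 ↔ Γ.graph.Adj u v := by
  refine ⟨fun h => ?_, fun h => ?_⟩
  · by_contra h'
    exact h (Γ.adjMatrix_of_not_adj h')
  · rcases Γ.adjMatrix_eq_one_or_neg_one h with h | h <;> simp [h]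

theorem adjMatrix_values (u v : V) :
    Γ.adjMatrix u v = 0 ∨ Γ.adjMatrix u v = 1 ∨ Γ.adjMatrix u v = -1 := by
  by_cases h : Γ.graph.Adj u v
  · exact Or.inr (Γ.adjMatrix_eq_one_or_neg_one h)
  · exact Or.inl (Γ.adjMatrix_of_not_adj h)

theorem isNegativeEdge_iff {u v : V} : Γ.IsNegativeEdge s(u, v) ↔ Γ.adjMatrix u v = -1 := by
  constructor
  · rintro ⟨h, h'⟩
    rw [Γ.adjMatrix_of_adj (SimpleGraph.mem_edgeSet _ |>.1 h), h']
    simp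
  · intro h
    have hadj : Γ.graph.Adj u v := Γ.adjMatrix_ne_zero_iff.1 (by rw [h]; norm_num)
    refine ⟨hadj, ?_⟩
    rw [Γ.adjMatrix_of_adj hadj] at h
    rcases Int.units_eq_one_or (Γ.sign ⟨s(u, v), hadj⟩) with h' | h'
    · rw [h'] at h; norm_num at h
    · exact h'

open Classical in
theorem neg_one_pow_countP_eq_prod {u v : V} (p : Γ.graph.Walk u v) :
    (-1 : ℝ) ^ (p.edges.countP fun e => decide (Γ.IsNegativeEdge e)) =
      (p.darts.map fun d => Γ.adjMatrix d.fst d.snd).prod := by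
  induction p with
  | nil => simp
  | cons h p ih =>
    rename_i a b c
    simp only [SimpleGraph.Walk.edges_cons, SimpleGraph.Walk.darts_cons, List.map_cons,
      List.prod_cons, List.countP_cons, ← ih, Γ.isNegativeEdge_iff]
    rcases Γ.adjMatrix_eq_one_or_neg_one h with h' | h'
    · simp [h', show ¬ ((1 : ℝ) = -1) by norm_num]
    · simp [h', pow_succ]

/-- If no entry were negative after switching by τ, every edge uv would have sign τ u τ v. The signs
along a walk then telescope to its two ends, giving 1 on a closed walk, against -1 on a negative
cycle. -/
theorem exists_neg_of_isUnbalanced (h : Γ.IsUnbalanced) (τ : V → ℤˣ) :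
    ∃ u v, ((τ u : ℤ) : ℝ) * Γ.adjMatrix u v * ((τ v : ℤ) : ℝ) < 0 := by
  by_contra! hτ
  have hsq : ∀ v, ((τ v : ℤ) : ℝ) * ((τ v : ℤ) : ℝ) = 1 := fun v => by
    rcases Int.units_eq_one_or (τ v) with h | h <;> simp [h]
  have key : ∀ {u v : V} (p : Γ.graph.Walk u v),
      (p.darts.map fun d => Γ.adjMatrix d.fst d.snd).prod =
        ((τ u : ℤ) : ℝ) * ((τ v : ℤ) : ℝ) := by
    intro u v p
    induction p with
    | nil => simp [hsq]
    | cons h p ih =>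
      rename_i a b c
      simp only [SimpleGraph.Walk.darts_cons, List.map_cons, List.prod_cons, ih]
      have h1 := hτ a b
      rcases Γ.adjMatrix_eq_one_or_neg_one h with h' | h' <;>
        rcases Int.units_eq_one_or (τ a) with ha | ha <;>
        rcases Int.units_eq_one_or (τ b) with hb | hb <;>
        first
        | (norm_num [h', ha, hb] at h1; done)
        | norm_num [h', ha, hb]
  obtain ⟨v, c, -, hodd⟩ := h
  have := Γ.neg_one_pow_countP_eq_prod c
  rw [key, hsq, hodd.neg_one_pow] at this
  norm_num at this

/-- For coinciding vertices the product is a product of squares, so no distinctness has to be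
assumed. -/
theorem fourCycle_prod_nonneg (h : ¬ Γ.HasNegativeC4) (x x' y y' : V) :
    0 ≤ Γ.adjMatrix x y * Γ.adjMatrix x' y * Γ.adjMatrix x' y' * Γ.adjMatrix x y' := by
  by_cases hx : x = x'
  · subst hx
    nlinarith [mul_self_nonneg (Γ.adjMatrix x y * Γ.adjMatrix x y')]
  by_cases hy : y = y'
  · subst hy
    nlinarith [mul_self_nonneg (Γ.adjMatrix x y * Γ.adjMatrix x' y)]
  by_contra! hneg
  have h1 : Γ.graph.Adj x y := Γ.adjMatrix_ne_zero_iff.1 fun h0 => by simp [h0] at hneg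
  have h2 : Γ.graph.Adj x' y := Γ.adjMatrix_ne_zero_iff.1 fun h0 => by simp [h0] at hneg
  have h3 : Γ.graph.Adj x' y' := Γ.adjMatrix_ne_zero_iff.1 fun h0 => by simp [h0] at hneg
  have h4 : Γ.graph.Adj x y' := Γ.adjMatrix_ne_zero_iff.1 fun h0 => by simp [h0] at hneg
  refine h ⟨x, .cons h1 (.cons h2.symm (.cons h3 (.cons h4.symm .nil))), by simp, ?_, ?_⟩
  · have := h1.ne; have := h2.ne; have := h3.ne; have := h4.ne
    simp only [SimpleGraph.Walk.cons_isCycle_iff, SimpleGraph.Walk.cons_isPath_iff,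
      SimpleGraph.Walk.support_cons, SimpleGraph.Walk.support_nil, SimpleGraph.Walk.edges_cons,
      SimpleGraph.Walk.edges_nil, List.mem_cons, Sym2.eq_iff]
    grind [SimpleGraph.Walk.IsPath.nil]
  · rw [← Nat.not_even_iff_odd]
    intro heven
    have := Γ.neg_one_pow_countP_eq_prod
      (.cons h1 (.cons h2.symm (.cons h3 (.cons h4.symm .nil))))
    rw [heven.neg_one_pow] at this
    simp only [SimpleGraph.Walk.darts_cons, SimpleGraph.Walk.darts_nil, List.map_cons,
      List.map_nil, List.prod_cons, List.prod_nil, Γ.adjMatrix_comm y x',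
      Γ.adjMatrix_comm y' x] at this
    linarith

theorem adjMatrix_switch (U : Set V) (τ : V → ℤˣ) (hτ : ∀ v, v ∈ U ↔ τ v = -1) (u v : V) :
    (Γ.switch U).adjMatrix u v = ((τ u : ℤ) : ℝ) * Γ.adjMatrix u v * ((τ v : ℤ) : ℝ) := by
  by_cases h : Γ.graph.Adj u v
  · have h' : (Γ.switch U).graph.Adj u v := h
    rw [adjMatrix_of_adj _ h', adjMatrix_of_adj _ h]
    have hiff : (∃ a b, a ∈ U ∧ b ∉ U ∧ s(u, v) = s(a, b)) ↔ τ u ≠ τ v := by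
      have hu := hτ u
      have hv := hτ v
      constructor
      · rintro ⟨a, b, ha, hb, hab⟩
        rcases Sym2.eq_iff.1 hab with ⟨rfl, rfl⟩ | ⟨rfl, rfl⟩ <;> grind
      · intro hne
        rcases Int.units_eq_one_or (τ u) with h1 | h1 <;>
          rcases Int.units_eq_one_or (τ v) with h2 | h2
        · grind
        · exact ⟨v, u, hv.2 h2, fun hm => by rw [hu.1 hm] at h1; exact absurd h1 (by decide),
            Sym2.eq_swap⟩
        · exact ⟨u, v, hu.2 h1, fun hm => by rw [hv.1 hm] at h2; exact absurd h2 (by decide), rfl⟩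
        · grind
    simp only [switch, hiff]
    rcases Int.units_eq_one_or (τ u) with h1 | h1 <;>
      rcases Int.units_eq_one_or (τ v) with h2 | h2 <;> simp [h1, h2]
  · have h' : ¬ (Γ.switch U).graph.Adj u v := h
    rw [adjMatrix_of_not_adj _ h', adjMatrix_of_not_adj _ h]
    simp

theorem isomorphic_iff {W : Type*} (Δ : SignedGraph W) :
    Δ.Isomorphic Γ ↔ ∃ e : W ≃ V, ∀ i j, Γ.adjMatrix (e i) (e j) = Δ.adjMatrix i j := by
  constructor
  · rintro ⟨φ, hφ⟩
    refine ⟨φ.toEquiv, fun i j => ?_⟩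
    by_cases h : Δ.graph.Adj i j
    · have h' : Γ.graph.Adj (φ i) (φ j) := φ.map_adj_iff.2 h
      have := hφ ⟨s(i, j), h⟩
      rw [Δ.adjMatrix_of_adj h, ← this]
      exact Γ.adjMatrix_of_adj h'
    · rw [Δ.adjMatrix_of_not_adj h]
      exact Γ.adjMatrix_of_not_adj fun h' => h (φ.map_adj_iff.1 h')
  · rintro ⟨e, he⟩
    refine ⟨⟨e, fun {i j} => ?_⟩, ?_⟩
    · rw [← adjMatrix_ne_zero_iff, ← adjMatrix_ne_zero_iff, he]
    · rintro ⟨⟨i, j⟩, h⟩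
      have h1 : Δ.graph.Adj i j := h
      have hij := he i j
      have h2 : Γ.graph.Adj (e i) (e j) := Γ.adjMatrix_ne_zero_iff.1 (by
        rw [hij]; exact Δ.adjMatrix_ne_zero_iff.2 h1)
      rw [Γ.adjMatrix_of_adj h2, Δ.adjMatrix_of_adj h1] at hij
      exact Units.ext (by exact_mod_cast hij)

theorem switchingIsomorphic_iff {W : Type*} (Δ : SignedGraph W) :
    Γ.SwitchingIsomorphic Δ ↔ ∃ (τ : V → ℤˣ) (e : W ≃ V), ∀ i j,
      ((τ (e i) : ℤ) : ℝ) * Γ.adjMatrix (e i) (e j) * ((τ (e j) : ℤ) : ℝ) = Δ.adjMatrix i j := by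
  classical
  constructor
  · rintro ⟨Γ', ⟨U, rfl⟩, hiso⟩
    obtain ⟨e, he⟩ := (isomorphic_iff _ _).1 hiso
    refine ⟨fun v => if v ∈ U then -1 else 1, e, fun i j => ?_⟩
    rw [← he, Γ.adjMatrix_switch U (fun v => if v ∈ U then -1 else 1)]
    intro v
    by_cases h : v ∈ U <;> simp [h]
  · rintro ⟨τ, e, he⟩
    refine ⟨Γ.switch {v | τ v = -1}, ⟨_, rfl⟩, (isomorphic_iff _ _).2 ⟨e, fun i j => ?_⟩⟩
    rw [← he]
    exact Γ.adjMatrix_switch _ τ (fun v => Iff.rfl) _ _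

end Basic

/-! ### The spectral radius as an eigenvalue -/

section SpectralRadius

open Matrix

variable {V : Type*} [Fintype V] [DecidableEq V] (Γ : SignedGraph V)

/-- Needed because `toReal` in `rho` would turn the value `⊤` into 0. -/
theorem spectralRadius_adjMatrix_lt_top : spectralRadius ℝ Γ.adjMatrix < ⊤ := by
  have hfin : (spectrum ℝ Γ.adjMatrix).Finite := Matrix.finite_real_spectrum
  obtain ⟨C, hC⟩ := (hfin.image (fun k => ‖k‖₊)).bddAbove
  refine lt_of_le_of_lt (iSup₂_le fun k hk => ?_) (ENNReal.coe_lt_top (r := C))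
  exact_mod_cast hC ⟨k, hk, rfl⟩

theorem abs_le_rho {x : V → ℝ} {μ : ℝ} (hx : x ≠ 0) (h : Γ.adjMatrix *ᵥ x = μ • x) :
    |μ| ≤ Γ.rho := by
  have hmem : μ ∈ spectrum ℝ Γ.adjMatrix := by
    rw [← Matrix.spectrum_toLin', ← Module.End.hasEigenvalue_iff_mem_spectrum]
    exact Module.End.hasEigenvalue_of_hasEigenvector (x := x)
      ⟨Module.End.mem_eigenspace_iff.2 (by simpa using h), hx⟩
  have hle : (‖μ‖₊ : ENNReal) ≤ spectralRadius ℝ Γ.adjMatrix := le_iSup₂ (α := ENNReal) μ hmem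
  have := ENNReal.toReal_mono Γ.spectralRadius_adjMatrix_lt_top.ne hle
  simpa [rho] using this

theorem exists_eigenvector_abs_eq_rho [Nonempty V] :
    ∃ (x : V → ℝ) (μ : ℝ), x ≠ 0 ∧ Γ.adjMatrix *ᵥ x = μ • x ∧ |μ| = Γ.rho := by
  have hA := Γ.isHermitian_adjMatrix
  obtain ⟨i, hi⟩ := Finite.exists_max fun i => |hA.eigenvalues i|
  refine ⟨⇑(hA.eigenvectorBasis i), hA.eigenvalues i, ?_, hA.mulVec_eigenvectorBasis i, ?_⟩
  · intro h0
    exact hA.eigenvectorBasis.orthonormal.ne_zero i (by ext j; exact congrFun h0 j)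
  · have hmem : hA.eigenvalues i ∈ spectrum ℝ Γ.adjMatrix := hA.eigenvalues_mem_spectrum_real i
    refine le_antisymm ?_ ?_
    · have hle : (‖hA.eigenvalues i‖₊ : ENNReal) ≤ spectralRadius ℝ Γ.adjMatrix :=
        le_iSup₂ (α := ENNReal) _ hmem
      have := ENNReal.toReal_mono Γ.spectralRadius_adjMatrix_lt_top.ne hle
      simpa [rho] using this
    · have hle : spectralRadius ℝ Γ.adjMatrix ≤ (‖hA.eigenvalues i‖₊ : ENNReal) := by
        refine iSup₂_le fun k hk => ?_
        rw [hA.spectrum_real_eq_range_eigenvalues] at hk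
        obtain ⟨j, rfl⟩ := hk
        exact_mod_cast hi j
      have := ENNReal.toReal_mono ENNReal.coe_ne_top hle
      simpa [rho] using this

theorem exists_eigenvector_rho [Nonempty V] (X : Set V)
    (hX : ∀ u v, Γ.graph.Adj u v → (u ∈ X ↔ v ∉ X)) :
    ∃ x : V → ℝ, x ≠ 0 ∧ Γ.adjMatrix *ᵥ x = Γ.rho • x := by
  classical
  obtain ⟨x, μ, hx, hAx, hμ⟩ := Γ.exists_eigenvector_abs_eq_rho
  rcases abs_choice μ with h | h
  · exact ⟨x, hx, by rw [hAx, ← hμ, h]⟩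
  -- Every edge leaves X or enters it, so negating x outside X turns the eigenvalue -ρ into ρ.
  · refine ⟨fun v => if v ∈ X then x v else - x v, fun h0 => hx ?_, ?_⟩
    · ext v
      have := congrFun h0 v
      by_cases hv : v ∈ X <;> simpa [hv] using this
    · ext v
      have hv := congrFun hAx v
      rw [← hμ, h]
      simp only [mulVec, dotProduct, Pi.smul_apply, smul_eq_mul] at hv ⊢
      have key : ∀ w, Γ.adjMatrix v w * (if w ∈ X then x w else - x w) =
          (if v ∈ X then -1 else 1) * (Γ.adjMatrix v w * x w) := by
        intro w
        by_cases hadj : Γ.graph.Adj v w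
        · have := hX v w hadj
          by_cases h1 : v ∈ X <;> by_cases h2 : w ∈ X <;> simp_all
        · simp [Γ.adjMatrix_of_not_adj hadj]
      simp_rw [key, ← Finset.mul_sum, hv]
      split_ifs <;> ring

end SpectralRadius

end SignedGraph

/-! ### The extremal quadratic and the eigenvalue equations of a blow-up -/

namespace SignedGraph

/-- The square of the bound: the larger root of `t² - ((r-1)(s-1)+2) t + (2r-3)(2s-3)`. -/
noncomputable def extremalSq (r s : ℝ) : ℝ :=
  1 / 2 * (((r - 1) * (s - 1) + 2) +
    Real.sqrt (((r - 1) * (s - 1) + 2) ^ 2 - 4 * (2 * r - 3) * (2 * s - 3)))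

theorem extremalSq_isRoot {r s : ℝ} (hr : 3 ≤ r) (hs : 3 ≤ s) :
    extremalSq r s ^ 2 - ((r - 1) * (s - 1) + 2) * extremalSq r s + (2 * r - 3) * (2 * s - 3)
      = 0 := by
  have hdisc : 0 ≤ ((r - 1) * (s - 1) + 2) ^ 2 - 4 * (2 * r - 3) * (2 * s - 3) := by
    -- In the shifted variables all coefficients are nonnegative; the discriminant vanishes at r = s
    -- = 3.
    obtain ⟨i, rfl⟩ : ∃ i, r = 3 + i := ⟨r - 3, by ring⟩
    obtain ⟨j, rfl⟩ : ∃ j, s = 3 + j := ⟨s - 3, by ring⟩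
    have hi : 0 ≤ i := by linarith
    have hj : 0 ≤ j := by linarith
    have : 0 ≤ 4 * i ^ 2 + 4 * j ^ 2 + 4 * i * j + i ^ 2 * j ^ 2 + 4 * i ^ 2 * j
        + 4 * i * j ^ 2 := by positivity
    linarith
  have hsq := Real.sq_sqrt hdisc
  unfold extremalSq
  linear_combination (1 / 4) * hsq

theorem half_le_extremalSq (r s : ℝ) : ((r - 1) * (s - 1) + 2) / 2 ≤ extremalSq r s := by
  have := Real.sqrt_nonneg (((r - 1) * (s - 1) + 2) ^ 2 - 4 * (2 * r - 3) * (2 * s - 3))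
  unfold extremalSq
  linarith

theorem three_le_extremalSq {r s : ℝ} (hr : 3 ≤ r) (hs : 3 ≤ s) : 3 ≤ extremalSq r s := by
  nlinarith [half_le_extremalSq r s]

theorem le_extremalSq {r s t : ℝ} (hr : 3 ≤ r) (hs : 3 ≤ s)
    (h : t ^ 2 - ((r - 1) * (s - 1) + 2) * t + (2 * r - 3) * (2 * s - 3) ≤ 0) :
    t ≤ extremalSq r s := by
  by_contra! hlt
  have := extremalSq_isRoot hr hs
  have := half_le_extremalSq r s
  nlinarith [mul_pos (sub_pos.2 hlt) (sub_pos.2 hlt)]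

/-- The equations satisfied by the values `y` of an eigenvector for the eigenvalue `μ` of a
blow-up of `blockMatrix` with parts of sizes `1, 1, a, b, d, c`. -/
structure IsBlockEigen (a b c d μ : ℝ) (y : Fin 6 → ℝ) : Prop where
  eq0 : μ * y 0 = -y 1 + b * y 3
  eq1 : μ * y 1 = -y 0 + a * y 2
  eq2 : μ * y 2 = y 1 + c * y 5
  eq3 : μ * y 3 = y 0 + d * y 4
  eq4 : μ * y 4 = b * y 3 + c * y 5
  eq5 : μ * y 5 = a * y 2 + d * y 4

namespace IsBlockEigen

variable {a b c d μ : ℝ} {y : Fin 6 → ℝ}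

/-- Exchange of the two sides of the bipartition. -/
theorem swap (h : IsBlockEigen a b c d μ y) :
    IsBlockEigen b a d c μ ![y 1, y 0, y 3, y 2, y 5, y 4] where
  eq0 := h.eq1
  eq1 := h.eq0
  eq2 := h.eq3
  eq3 := h.eq2
  eq4 := by simpa using h.eq5
  eq5 := by simpa using h.eq4

/-- Row 4 of `blockMatrix` is the sum of rows 0 and 2. -/
theorem y4_eq (h : IsBlockEigen a b c d μ y) (hμ : 0 < μ) : y 4 = y 0 + y 2 := by
  refine mul_left_cancel₀ hμ.ne' ?_
  linear_combination h.eq4 - h.eq0 - h.eq2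

theorem y5_eq (h : IsBlockEigen a b c d μ y) (hμ : 0 < μ) : y 5 = y 1 + y 3 := by
  refine mul_left_cancel₀ hμ.ne' ?_
  linear_combination h.eq5 - h.eq1 - h.eq3

/-- Applying the equations twice returns to the same side of the bipartition. With y 4 eliminated,
only y 0 and y 2 remain, so μ² is governed by a 2 × 2 system. -/
theorem sq_mul_y0 (h : IsBlockEigen a b c d μ y) (hμ : 0 < μ) :
    μ ^ 2 * y 0 = (1 + b + b * d) * y 0 + (b * d - a) * y 2 := by
  have h4 := h.y4_eq hμ
  linear_combination μ * h.eq0 - h.eq1 + b * h.eq3 + b * d * h4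

theorem sq_mul_y2 (h : IsBlockEigen a b c d μ y) (hμ : 0 < μ) :
    μ ^ 2 * y 2 = (c * d - 1) * y 0 + (a + c * a + c * d) * y 2 := by
  have h4 := h.y4_eq hμ
  linear_combination μ * h.eq2 + h.eq1 + c * h.eq5 + c * d * h4

theorem eq_zero (h : IsBlockEigen a b c d μ y) (hμ : 0 < μ) (h0 : y 0 = 0) (h2 : y 2 = 0) :
    y = 0 := by
  have h4 := h.y4_eq hμ
  have e1 := h.eq1
  have e3 := h.eq3
  have e5 := h.eq5
  rw [h0, h2] at h4 e1
  rw [h4, h0] at e3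
  rw [h4, h2] at e5
  have h1 : y 1 = 0 := by
    have : μ * y 1 = 0 := by linarith
    exact (mul_eq_zero.1 this).resolve_left hμ.ne'
  have h3 : y 3 = 0 := by
    have : μ * y 3 = 0 := by linarith
    exact (mul_eq_zero.1 this).resolve_left hμ.ne'
  have h5 : y 5 = 0 := by
    have : μ * y 5 = 0 := by linarith
    exact (mul_eq_zero.1 this).resolve_left hμ.ne'
  ext i
  fin_cases i <;> simp [h0, h1, h2, h3, h4, h5]

/-- The left side is the determinant of the 2 × 2 system for y 0 and y 2; by Cramer's rule both
vanish, and y with them, unless it is 0. -/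
theorem charpoly_eq (h : IsBlockEigen a b c d μ y) (hμ : 0 < μ) (hy : y ≠ 0) :
    (μ ^ 2) ^ 2 - ((a + d) * (b + c) + 2 - (a - 1) * (b - 1)) * μ ^ 2 +
      (a + d + a * d) * (b + c + b * c) = 0 := by
  have e0 := h.sq_mul_y0 hμ
  have e2 := h.sq_mul_y2 hμ
  set P := (μ ^ 2) ^ 2 - ((a + d) * (b + c) + 2 - (a - 1) * (b - 1)) * μ ^ 2 +
      (a + d + a * d) * (b + c + b * c) with hP
  have h0 : P * y 0 = 0 := by
    rw [hP]
    linear_combination (μ ^ 2 - (a + c * a + c * d)) * e0 + (b * d - a) * e2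
  have h2 : P * y 2 = 0 := by
    rw [hP]
    linear_combination (μ ^ 2 - (1 + b + b * d)) * e2 + (c * d - 1) * e0
  by_contra hne
  exact hy (h.eq_zero hμ ((mul_eq_zero.1 h0).resolve_left hne) ((mul_eq_zero.1 h2).resolve_left hne))

theorem sq_le (h : IsBlockEigen a b c d μ y) (hμ : 0 < μ) (hy : y ≠ 0)
    (ha : 1 ≤ a) (hb : 1 ≤ b) (hc : 1 ≤ c) (hd : 1 ≤ d) :
    μ ^ 2 ≤ extremalSq (1 + a + d) (1 + b + c) ∧
      (μ ^ 2 = extremalSq (1 + a + d) (1 + b + c) →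
        (a - 1) * (b - 1) = 0 ∧ (a - 1) * (d - 1) = 0 ∧ (b - 1) * (c - 1) = 0) := by
  have hchar := h.charpoly_eq hμ hy
  have hab : 0 ≤ (a - 1) * (b - 1) := mul_nonneg (by linarith) (by linarith)
  have had : 0 ≤ (a - 1) * (d - 1) := mul_nonneg (by linarith) (by linarith)
  have hbc : 0 ≤ (b - 1) * (c - 1) := mul_nonneg (by linarith) (by linarith)
  have ht : 0 < μ ^ 2 := by positivity
  have h1 : 0 ≤ (a - 1) * (b - 1) * μ ^ 2 := by positivity
  have h2 : 0 ≤ (a - 1) * (d - 1) * (2 * (b + c) - 1) := mul_nonneg had (by linarith)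
  have h3 : 0 ≤ (b - 1) * (c - 1) * (2 * (a + d) - 1) := mul_nonneg hbc (by linarith)
  have h4 : 0 ≤ (a - 1) * (d - 1) * ((b - 1) * (c - 1)) := mul_nonneg had hbc
  -- Rests on a + d + ad = (2(a+d) - 1) + (a-1)(d-1), and likewise for b and c.
  have hid : (μ ^ 2) ^ 2 - ((1 + a + d - 1) * (1 + b + c - 1) + 2) * μ ^ 2 +
      (2 * (1 + a + d) - 3) * (2 * (1 + b + c) - 3) =
      -((a - 1) * (b - 1) * μ ^ 2 + (a - 1) * (d - 1) * (2 * (b + c) - 1) +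
        (b - 1) * (c - 1) * (2 * (a + d) - 1) + (a - 1) * (d - 1) * ((b - 1) * (c - 1))) := by
    linear_combination hchar
  refine ⟨le_extremalSq (by linarith) (by linarith) (by linarith), fun heq => ?_⟩
  have hroot := extremalSq_isRoot (r := 1 + a + d) (s := 1 + b + c) (by linarith) (by linarith)
  rw [← heq, hid] at hroot
  refine ⟨?_, ?_, ?_⟩
  · have : (a - 1) * (b - 1) * μ ^ 2 = 0 := by linarith
    exact (mul_eq_zero.1 this).resolve_right ht.ne'
  · have : (a - 1) * (d - 1) * (2 * (b + c) - 1) = 0 := by linarith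
    exact (mul_eq_zero.1 this).resolve_right (by linarith)
  · have : (b - 1) * (c - 1) * (2 * (a + d) - 1) = 0 := by linarith
    exact (mul_eq_zero.1 this).resolve_right (by linarith)

theorem eq_zero_of_y2 (h : IsBlockEigen a b c d μ y) (hμ : 0 < μ) (hc : 1 ≤ c)
    (hy : ∀ i, 0 ≤ y i) (h2 : y 2 = 0) : y = 0 := by
  have e2 := h.eq2
  have h5 : y 5 = 0 := by nlinarith [hy 1, hy 5]
  have h1 : y 1 = 0 := by rw [h2, h5] at e2; linarith
  have h3 : y 3 = 0 := by have := h.y5_eq hμ; linarith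
  have h0 : y 0 = 0 := by
    have e0 := h.eq0
    rw [h1, h3] at e0
    have : μ * y 0 = 0 := by linarith
    exact (mul_eq_zero.1 this).resolve_left hμ.ne'
  exact h.eq_zero hμ h0 h2

theorem eq_zero_of_y4 (h : IsBlockEigen a b c d μ y) (hμ : 0 < μ)
    (hy : ∀ i, 0 ≤ y i) (h4 : y 4 = 0) : y = 0 := by
  have := h.y4_eq hμ
  exact h.eq_zero hμ (by linarith [hy 0, hy 2]) (by linarith [hy 0, hy 2])

theorem swap_nonneg (hy : ∀ i, 0 ≤ y i) :
    ∀ i, 0 ≤ (![y 1, y 0, y 3, y 2, y 5, y 4] : Fin 6 → ℝ) i := by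
  intro i
  fin_cases i <;> simp [hy]

theorem eq_zero_of_swap_eq_zero
    (h : (![y 1, y 0, y 3, y 2, y 5, y 4] : Fin 6 → ℝ) = 0) : y = 0 := by
  ext i
  have h0 := congrFun h 0
  have h1 := congrFun h 1
  have h2 := congrFun h 2
  have h3 := congrFun h 3
  have h4 := congrFun h 4
  have h5 := congrFun h 5
  simp at h0 h1 h2 h3 h4 h5
  fin_cases i <;> simp [*]

/-- For nonnegative y, a zero at class 4 spreads through y 4 = y 0 + y 2, a zero at class 2 through
μ y 2 = y 1 + c y 5; classes 3 and 5 follow by symmetry. -/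
theorem pos_of_two_le (h : IsBlockEigen a b c d μ y) (hμ : 0 < μ) (hc : 1 ≤ c) (hd : 1 ≤ d)
    (hy : ∀ i, 0 ≤ y i) (hne : y ≠ 0) (i : Fin 6) (hi : 2 ≤ i) : 0 < y i := by
  refine lt_of_le_of_ne (hy i) fun h0 => hne ?_
  fin_cases i
  · simp at hi
  · simp at hi
  · exact h.eq_zero_of_y2 hμ hc hy h0.symm
  · exact eq_zero_of_swap_eq_zero
      (h.swap.eq_zero_of_y2 hμ hd (swap_nonneg hy) (by simpa using h0.symm))
  · exact h.eq_zero_of_y4 hμ hy h0.symm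
  · exact eq_zero_of_swap_eq_zero
      (h.swap.eq_zero_of_y4 hμ (swap_nonneg hy) (by simpa using h0.symm))

/-- The vanishing products also allow a > 1 with b = d = 1: this is Γ_{r,s} switched so that an end
edge of the path is negative. Nonnegativity of y excludes it, since (μ² - 3) y 0 = -(a-1) y 2 would
be negative. -/
theorem a_le_one (h : IsBlockEigen a b c d μ y) (hμ : 0 < μ) (hμ3 : 3 ≤ μ ^ 2) (hc : 1 ≤ c)
    (hd : 1 ≤ d) (hy : ∀ i, 0 ≤ y i) (hne : y ≠ 0)
    (hab : (a - 1) * (b - 1) = 0) (had : (a - 1) * (d - 1) = 0) : a ≤ 1 := by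
  by_contra! ha
  have ha' : a - 1 ≠ 0 := by linarith
  have hb : b = 1 := by linarith [(mul_eq_zero.1 hab).resolve_left ha']
  have hd1 : d = 1 := by linarith [(mul_eq_zero.1 had).resolve_left ha']
  have e0 := h.sq_mul_y0 hμ
  rw [hb, hd1] at e0
  have hpos := h.pos_of_two_le hμ hc hd hy hne 2 le_rfl
  nlinarith [mul_pos (sub_pos.2 ha) hpos, mul_nonneg (sub_nonneg.2 hμ3) (hy 0)]

theorem eq_one_of_sq_eq (h : IsBlockEigen a b c d μ y) (hμ : 0 < μ) (hne : y ≠ 0)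
    (hy : ∀ i, 0 ≤ y i) (ha : 1 ≤ a) (hb : 1 ≤ b) (hc : 1 ≤ c) (hd : 1 ≤ d)
    (heq : μ ^ 2 = extremalSq (1 + a + d) (1 + b + c)) : a = 1 ∧ b = 1 := by
  obtain ⟨hab, had, hbc⟩ := (h.sq_le hμ hne ha hb hc hd).2 heq
  have h3 : 3 ≤ μ ^ 2 := heq ▸ three_le_extremalSq (by linarith) (by linarith)
  refine ⟨le_antisymm (h.a_le_one hμ h3 hc hd hy hne hab had) ha, le_antisymm
    (h.swap.a_le_one hμ h3 hd hc (swap_nonneg hy) (fun h0 => hne (eq_zero_of_swap_eq_zero h0))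
      (by linarith) hbc) hb⟩

end IsBlockEigen

theorem exists_isBlockEigen_extremal {r s : ℝ} (hr : 3 ≤ r) (hs : 3 ≤ s) :
    ∃ y : Fin 6 → ℝ, y ≠ 0 ∧ y 4 = y 0 + y 2 ∧
      IsBlockEigen 1 1 (s - 2) (r - 2) (Real.sqrt (extremalSq r s)) y := by
  set t := extremalSq r s with ht
  have hroot := extremalSq_isRoot hr hs
  rw [← ht] at hroot
  have ht3 : 3 ≤ t := three_le_extremalSq hr hs
  have hμ : 0 < Real.sqrt t := Real.sqrt_pos.2 (by linarith)
  have hsq : Real.sqrt t ^ 2 = t := Real.sq_sqrt (by linarith)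
  set μ := Real.sqrt t
  -- The system of `sq_mul_y0` and `sq_mul_y2` at a = b = 1, c = s - 2, d = r - 2; its determinant
  -- is the extremal quadratic. The other coordinates are then read off `eq1`, `eq3`, `eq5` and y 4
  -- = y 0 + y 2.
  obtain ⟨w, hw, hMw⟩ := (Matrix.exists_mulVec_eq_zero_iff
    (M := !![t - r, -(r - 3); -((s - 2) * (r - 2) - 1), t - (1 + (s - 2) * (r - 1))])).2 (by
      rw [Matrix.det_fin_two_of]; linear_combination hroot)
  have e0 := congrFun hMw 0
  have e1 := congrFun hMw 1
  simp [Matrix.mulVec, dotProduct, Fin.sum_univ_two] at e0 e1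
  refine ⟨![w 0, (-w 0 + w 1) / μ, w 1, (w 0 + (r - 2) * (w 0 + w 1)) / μ, w 0 + w 1,
    (w 1 + (r - 2) * (w 0 + w 1)) / μ], ?_, by simp, ?_⟩
  · intro h0
    refine hw ?_
    ext i
    fin_cases i
    · simpa using congrFun h0 0
    · simpa using congrFun h0 2
  · constructor <;> simp <;> field_simp <;> rw [hsq] <;> linarith

end SignedGraph

/-! ### The Rayleigh bound and eigenvectors of blow-ups -/

namespace SignedGraph

open Matrix Finset

/-- A real symmetric matrix on a nonempty index set has a largest eigenvalue; it bounds the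
quadratic form, and only eigenvectors attain the bound. -/
theorem exists_max_eigenvalue {V : Type*} [Fintype V] [DecidableEq V] [Nonempty V]
    {B : Matrix V V ℝ} (hB : B.IsHermitian) :
    ∃ (μ : ℝ) (z : V → ℝ), z ≠ 0 ∧ B *ᵥ z = μ • z ∧ (∀ x, x ⬝ᵥ B *ᵥ x ≤ μ * (x ⬝ᵥ x)) ∧
      ∀ x, x ⬝ᵥ B *ᵥ x = μ * (x ⬝ᵥ x) → B *ᵥ x = μ • x := by
  obtain ⟨i, hi⟩ := Finite.exists_max hB.eigenvalues
  set μ := hB.eigenvalues i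
  have hM : (μ • (1 : Matrix V V ℝ) - B).IsHermitian :=
    (Matrix.isHermitian_one.smul (by simp [IsSelfAdjoint])).sub hB
  have hmul : ∀ x, (μ • (1 : Matrix V V ℝ) - B) *ᵥ x = μ • x - B *ᵥ x := fun x => by
    rw [Matrix.sub_mulVec, Matrix.smul_mulVec, Matrix.one_mulVec]
  -- An eigenvalue ν of μI - B yields the eigenvalue μ - ν ≤ μ of B. Zeros of a semidefinite form
  -- lie in the kernel, which settles the equality clause.
  have hpsd : (μ • (1 : Matrix V V ℝ) - B).PosSemidef := by
    rw [hM.posSemidef_iff_eigenvalues_nonneg]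
    intro j
    have hj := hM.mulVec_eigenvectorBasis j
    rw [hmul] at hj
    have hne : (⇑(hM.eigenvectorBasis j) : V → ℝ) ≠ 0 := fun h0 =>
      hM.eigenvectorBasis.orthonormal.ne_zero j (by ext l; exact congrFun h0 l)
    have hmem : μ - hM.eigenvalues j ∈ spectrum ℝ B := by
      rw [← Matrix.spectrum_toLin', ← Module.End.hasEigenvalue_iff_mem_spectrum]
      refine Module.End.hasEigenvalue_of_hasEigenvector (x := ⇑(hM.eigenvectorBasis j))
        ⟨Module.End.mem_eigenspace_iff.2 ?_, hne⟩
      rw [Matrix.toLin'_apply, sub_smul, ← hj]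
      abel
    rw [hB.spectrum_real_eq_range_eigenvalues] at hmem
    obtain ⟨l, hl⟩ := hmem
    have := hi l
    simp only [Pi.zero_apply]
    linarith
  have hq : ∀ x : V → ℝ, x ⬝ᵥ (μ • (1 : Matrix V V ℝ) - B) *ᵥ x =
      μ * (x ⬝ᵥ x) - x ⬝ᵥ B *ᵥ x := fun x => by
    rw [hmul, dotProduct_sub, dotProduct_smul, smul_eq_mul]
  refine ⟨μ, ⇑(hB.eigenvectorBasis i), fun h0 =>
      hB.eigenvectorBasis.orthonormal.ne_zero i (by ext l; exact congrFun h0 l),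
    hB.mulVec_eigenvectorBasis i, fun x => ?_, fun x hx => ?_⟩
  · have := hpsd.dotProduct_mulVec_nonneg x
    rw [star_trivial, hq] at this
    linarith
  · have := (hpsd.dotProduct_mulVec_zero_iff x).1 (by rw [star_trivial, hq, hx, sub_self])
    rw [hmul] at this
    exact (sub_eq_zero.1 this).symm

/-- The pattern of `Γ_{r,s}` and of its blow-ups: class `0` is `x₀`, class `1` is `y₀`, classes `2`
and `3` are their positive neighbours, classes `4` and `5` the remaining vertices on the sides of
`x₀` and `y₀`. -/
def blockMatrix : Matrix (Fin 6) (Fin 6) ℝ :=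
  !![0, -1, 0, 1, 0, 0;
     -1, 0, 1, 0, 0, 0;
     0, 1, 0, 0, 0, 1;
     1, 0, 0, 0, 1, 0;
     0, 0, 0, 1, 0, 1;
     0, 0, 1, 0, 1, 0]

theorem blockMatrix_comm (i j : Fin 6) : blockMatrix i j = blockMatrix j i := by
  fin_cases i <;> fin_cases j <;> rfl

section Blowup

variable {V : Type*} [Fintype V] (k : V → Fin 6)

/-- The size of the part `c` of a blow-up. -/
def partSize (c : Fin 6) : ℕ := (univ.filter fun v => k v = c).card

theorem sum_comp_part (f : Fin 6 → ℝ) : ∑ w, f (k w) = ∑ c, (partSize k c : ℝ) * f c := by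
  rw [← Finset.sum_fiberwise' univ k f]
  simp [partSize]

variable {k}

/-- The order 2, 3, 5, 4 is that of a, b, c, d: parts 2 and 4 are on the side of class 0. -/
theorem isBlockEigen_of_mul_eq (h0 : partSize k 0 = 1) (h1 : partSize k 1 = 1) {μ : ℝ}
    {y : Fin 6 → ℝ} (hy : ∀ c, μ * y c = ∑ w, blockMatrix c (k w) * y (k w)) :
    IsBlockEigen (partSize k 2) (partSize k 3) (partSize k 5) (partSize k 4) μ y := by
  have hy' : ∀ c, μ * y c = ∑ j, (partSize k j : ℝ) * (blockMatrix c j * y j) := fun c => by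
    rw [hy, sum_comp_part k fun j => blockMatrix c j * y j]
  constructor <;> rw [hy'] <;> simp [Fin.sum_univ_six, blockMatrix, h0, h1]

theorem exists_isBlockEigen (h0 : partSize k 0 = 1) (h1 : partSize k 1 = 1) {μ : ℝ} (hμ : 0 < μ)
    {x : V → ℝ} (hx : x ≠ 0) (h : blockMatrix.submatrix k k *ᵥ x = μ • x) :
    ∃ y : Fin 6 → ℝ, y ≠ 0 ∧ (∀ w, x w = y (k w)) ∧
      IsBlockEigen (partSize k 2) (partSize k 3) (partSize k 5) (partSize k 4) μ y := by
  have hxy : ∀ w, x w = (∑ z, blockMatrix (k w) (k z) * x z) / μ := fun w => by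
    have := congrFun h w
    simp only [mulVec, dotProduct, submatrix_apply, Pi.smul_apply, smul_eq_mul] at this
    rw [this, mul_div_cancel_left₀ _ hμ.ne']
  -- y c is computed from row c rather than from a representative, so empty parts do no harm.
  refine ⟨fun c => (∑ w, blockMatrix c (k w) * x w) / μ, fun hy => hx ?_, hxy,
    isBlockEigen_of_mul_eq h0 h1 fun c => ?_⟩
  · ext w
    rw [hxy]
    exact congrFun hy (k w)
  · simp only [← hxy]
    rw [mul_div_cancel₀ _ hμ.ne']

end Blowup

/-! ### Switching of matrices and its normalization -/

variable {V : Type*}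

/-- The matrix obtained by switching the sign of the rows and columns `v` with `τ v = -1`. -/
def switchMatrix (A : Matrix V V ℝ) (τ : V → ℤˣ) : Matrix V V ℝ :=
  of fun u v => ((τ u : ℤ) : ℝ) * A u v * ((τ v : ℤ) : ℝ)

theorem switchMatrix_apply (A : Matrix V V ℝ) (τ : V → ℤˣ) (u v : V) :
    switchMatrix A τ u v = ((τ u : ℤ) : ℝ) * A u v * ((τ v : ℤ) : ℝ) := rfl

theorem unit_mul_self (ε : ℤˣ) : ((ε : ℤ) : ℝ) * ((ε : ℤ) : ℝ) = 1 := by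
  rcases Int.units_eq_one_or ε with h | h <;> simp [h]

theorem switchMatrix_switchMatrix (A : Matrix V V ℝ) (τ τ' : V → ℤˣ) :
    switchMatrix (switchMatrix A τ) τ' = switchMatrix A (τ' * τ) := by
  ext u v
  simp only [switchMatrix_apply, Pi.mul_apply, Units.val_mul, Int.cast_mul]
  ring

/-- `A` is the adjacency matrix of an unbalanced signed bipartite graph without negative
4-cycles, where `X` is one side of the bipartition. -/
structure IsUnbalancedC4Free (A : Matrix V V ℝ) (X : Finset V) : Prop where
  comm : ∀ u v, A u v = A v u
  values : ∀ u v, A u v = 0 ∨ A u v = 1 ∨ A u v = -1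
  bipartite : ∀ u v, A u v ≠ 0 → (u ∈ X ↔ v ∉ X)
  fourCycle : ∀ x x' y y', 0 ≤ A x y * A x' y * A x' y' * A x y'
  unbalanced : ∀ τ : V → ℤˣ, ∃ u v, switchMatrix A τ u v < 0

namespace IsUnbalancedC4Free

variable {A : Matrix V V ℝ} {X : Finset V}

theorem switch (h : IsUnbalancedC4Free A X) (τ : V → ℤˣ) :
    IsUnbalancedC4Free (switchMatrix A τ) X where
  comm u v := by rw [switchMatrix_apply, switchMatrix_apply, h.comm u v]; ring
  values u v := by
    rw [switchMatrix_apply]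
    rcases h.values u v with h | h | h <;> rcases Int.units_eq_one_or (τ u) with h1 | h1 <;>
      rcases Int.units_eq_one_or (τ v) with h2 | h2 <;> simp [h, h1, h2]
  bipartite u v huv := h.bipartite u v fun h0 => huv (by simp [switchMatrix_apply, h0])
  fourCycle x x' y y' := by
    simp only [switchMatrix_apply]
    have := h.fourCycle x x' y y'
    have e1 := unit_mul_self (τ x)
    have e2 := unit_mul_self (τ x')
    have e3 := unit_mul_self (τ y)
    have e4 := unit_mul_self (τ y')
    refine this.trans_eq ?_
    calc A x y * A x' y * A x' y' * A x y' = A x y * A x' y * A x' y' * A x y' *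
          (((τ x : ℤ) : ℝ) * ((τ x : ℤ) : ℝ)) * (((τ x' : ℤ) : ℝ) * ((τ x' : ℤ) : ℝ)) *
          (((τ y : ℤ) : ℝ) * ((τ y : ℤ) : ℝ)) * (((τ y' : ℤ) : ℝ) * ((τ y' : ℤ) : ℝ)) := by
            rw [e1, e2, e3, e4]; ring
      _ = _ := by ring
  unbalanced τ' := by
    rw [switchMatrix_switchMatrix]
    exact h.unbalanced _

theorem le_zero_of_ne_one (h : IsUnbalancedC4Free A X) {u v : V} (hne : A u v ≠ 1) :
    A u v ≤ 0 := by
  rcases h.values u v with h' | h' | h'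
  · exact h'.le
  · exact absurd h' hne
  · rw [h']; norm_num

theorem le_one (h : IsUnbalancedC4Free A X) (u v : V) : A u v ≤ 1 := by
  rcases h.values u v with h' | h' | h' <;> rw [h'] <;> norm_num

theorem eq_one_of_pos (h : IsUnbalancedC4Free A X) {u v : V} (hp : 0 < A u v) : A u v = 1 := by
  by_contra hne
  exact absurd (h.le_zero_of_ne_one hne) (not_le.2 hp)

theorem eq_neg_one_of_neg (h : IsUnbalancedC4Free A X) {u v : V} (hn : A u v < 0) :
    A u v = -1 := by
  rcases h.values u v with h' | h' | h'
  · rw [h'] at hn; exact absurd hn (lt_irrefl _)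
  · rw [h'] at hn; norm_num at hn
  · exact h'

theorem eq_zero_of_same_side (h : IsUnbalancedC4Free A X) {u v : V} (hs : u ∈ X ↔ v ∈ X) :
    A u v = 0 := by
  by_contra hne
  have := h.bipartite u v hne
  tauto

/-- No vertex is adjacent to the whole other side. -/
theorem exists_eq_zero (h : IsUnbalancedC4Free A X) (v : V) :
    ∃ w, (w ∈ X ↔ v ∉ X) ∧ A v w = 0 := by
  classical
  by_contra! hfull
  -- Flip the negative neighbours of v and each vertex on the side of v that disagrees in sign with
  -- v at some common neighbour. Without negative 4-cycles such a vertex disagrees with v at all its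
  -- neighbours, so no negative entry would survive.
  obtain ⟨p, q, hpq⟩ := h.unbalanced fun w =>
    if A v w < 0 ∨ ∃ u, A w u * A v u < 0 then -1 else 1
  rw [switchMatrix_apply] at hpq
  wlog hp : p ∈ X ↔ v ∈ X generalizing p q
  · refine this q p (lt_of_eq_of_lt (by rw [h.comm q p]; ring) hpq) ?_
    have hne : A p q ≠ 0 := fun h0 => by simp [h0] at hpq
    have := h.bipartite p q hne
    tauto
  have hne : A p q ≠ 0 := fun h0 => by simp [h0] at hpq
  have hq : q ∈ X ↔ v ∉ X := by
    have := h.bipartite p q hne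
    tauto
  have hp0 : A v p = 0 := h.eq_zero_of_same_side hp.symm
  have hqu : ∀ u, A q u * A v u = 0 := fun u => by
    by_cases hu : u ∈ X ↔ v ∈ X
    · rw [h.eq_zero_of_same_side hu.symm, mul_zero]
    · rw [h.eq_zero_of_same_side (u := q) (v := u) (by tauto), zero_mul]
  simp only [hp0, hqu, lt_irrefl, exists_false, or_false, false_or] at hpq
  have hvq := hfull q hq
  by_cases hex : ∃ u, A p u * A v u < 0
  · obtain ⟨u, hu⟩ := hex
    rw [if_pos ⟨u, hu⟩] at hpq
    have h4 := h.fourCycle p v q u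
    rcases (h.values p q).resolve_left hne with h1 | h1 <;>
      rcases (h.values v q).resolve_left hvq with h2 | h2 <;>
      (try norm_num [h1, h2] at hpq) <;> norm_num [h1, h2] at h4 <;> nlinarith
  · rw [if_neg hex] at hpq
    push Not at hex
    have h4 := hex q
    rcases (h.values p q).resolve_left hne with h1 | h1 <;>
      rcases (h.values v q).resolve_left hvq with h2 | h2 <;>
      (try norm_num [h1, h2] at hpq) <;> norm_num [h1, h2] at h4

variable [Fintype V]

theorem mulVec_switch {σ : ℝ} {x : V → ℝ} (hAx : A *ᵥ x = σ • x) (τ : V → ℤˣ) :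
    switchMatrix A τ *ᵥ (fun v => ((τ v : ℤ) : ℝ) * x v) =
      σ • fun v => ((τ v : ℤ) : ℝ) * x v := by
  ext u
  have hu := congrFun hAx u
  simp only [mulVec, dotProduct, Pi.smul_apply, smul_eq_mul, switchMatrix_apply] at hu ⊢
  rw [mul_left_comm, ← hu, Finset.mul_sum]
  refine Finset.sum_congr rfl fun w _ => ?_
  linear_combination ((τ u : ℤ) : ℝ) * A u w * x w * unit_mul_self (τ w)

/-- An eigenvector for a positive eigenvalue can be made nonnegative by a switching after which
every vertex on a negative edge is also on a positive edge. -/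
theorem exists_switch (h : IsUnbalancedC4Free A X) {σ : ℝ} (hσ : 0 < σ) {x : V → ℝ}
    (hAx : A *ᵥ x = σ • x) :
    ∃ τ : V → ℤˣ, (∀ v, 0 ≤ ((τ v : ℤ) : ℝ) * x v) ∧
      ∀ u v, switchMatrix A τ u v < 0 → ∃ w, 0 < switchMatrix A τ u w := by
  classical
  let S : (V → ℤˣ) → Finset (V × V) := fun τ =>
    univ.filter fun p => switchMatrix A τ p.1 p.2 < 0
  -- Among the switchings that make x nonnegative, take one with the fewest negative entries.
  obtain ⟨τ, hτ, hmin⟩ := Finset.exists_min_image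
    (univ.filter fun τ : V → ℤˣ => ∀ v, 0 ≤ ((τ v : ℤ) : ℝ) * x v) (fun τ => (S τ).card)
    ⟨fun v => if x v < 0 then -1 else 1, by
      simp only [mem_filter, mem_univ, true_and]
      intro v
      split_ifs with hv
      · simp; linarith
      · simpa using hv⟩
  simp only [mem_filter, mem_univ, true_and] at hτ hmin
  refine ⟨τ, hτ, fun u v huv => ?_⟩
  by_contra! hle
  have hux := congrFun (mulVec_switch hAx τ) u
  simp only [mulVec, dotProduct, Pi.smul_apply, smul_eq_mul] at hux
  -- A row u without positive entries forces x u = 0. Flipping u then keeps x nonnegative and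
  -- removes the negative entries at u, against minimality.
  have hsum : ∑ w, switchMatrix A τ u w * (((τ w : ℤ) : ℝ) * x w) ≤ 0 :=
    Finset.sum_nonpos fun w _ => mul_nonpos_of_nonpos_of_nonneg (hle w) (hτ w)
  have hu0 : ((τ u : ℤ) : ℝ) * x u = 0 := by nlinarith [hτ u]
  have hτ' : ∀ w, 0 ≤ ((Function.update τ u (-τ u) w : ℤ) : ℝ) * x w := fun w => by
    by_cases hw : w = u
    · subst hw; simp; linarith
    · simpa [hw] using hτ w
  have huu : A u u = 0 := h.eq_zero_of_same_side Iff.rfl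
  have hle' : ∀ w, switchMatrix A τ w u ≤ 0 := fun w => by
    rw [(h.switch τ).comm]; exact hle w
  have hrow : ∀ w, 0 ≤ switchMatrix A (Function.update τ u (-τ u)) u w := fun w => by
    by_cases hw : w = u
    · subst hw; simp [switchMatrix_apply, huu]
    · have := hle w
      simp only [switchMatrix_apply] at this
      simp [switchMatrix_apply, hw]
      linarith
  have hcol : ∀ w, 0 ≤ switchMatrix A (Function.update τ u (-τ u)) w u := fun w => by
    rw [(h.switch _).comm]; exact hrow w
  refine absurd (hmin _ hτ') (not_le.2 (Finset.card_lt_card ?_))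
  rw [Finset.ssubset_iff_of_subset]
  · refine ⟨(u, v), by simpa [S] using huv, ?_⟩
    simpa [S] using hrow v
  · rintro ⟨p, q⟩ hpq
    simp only [S, mem_filter, mem_univ, true_and] at hpq ⊢
    by_cases hp : p = u
    · subst hp; exact absurd hpq (not_lt.2 (hrow q))
    by_cases hq : q = u
    · subst hq; exact absurd hpq (not_lt.2 (hcol p))
    simpa [switchMatrix_apply, hp, hq] using hpq

end IsUnbalancedC4Free

end SignedGraph

/-! ### The six classes relative to a negative edge -/

namespace SignedGraph

open Matrix Finset

theorem exists_equiv_of_partSize_eq {V W : Type*} [Fintype V] [Fintype W] {k : V → Fin 6}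
    {l : W → Fin 6} (h : ∀ c, partSize k c = partSize l c) : ∃ e : W ≃ V, ∀ i, k (e i) = l i := by
  have hc : ∀ c, Nonempty ({i // l i = c} ≃ {v // k v = c}) := fun c => by
    refine ⟨Fintype.equivOfCardEq ?_⟩
    rw [Fintype.card_subtype, Fintype.card_subtype]
    exact (h c).symm
  exact ⟨Equiv.ofFiberEquiv fun c => (hc c).some, Equiv.ofFiberEquiv_map _⟩

open Classical in
/-- The class of a vertex relative to the negative edge `uv` with `u ∈ X`. -/
noncomputable def edgeClass {V : Type*} (A : Matrix V V ℝ) (X : Finset V) (u v w : V) : Fin 6 :=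
  if w ∈ X then (if w = u then 0 else if A w v = 1 then 2 else 4)
  else (if w = v then 1 else if A u w = 1 then 3 else 5)

section EdgeClass

variable {V : Type*} {A : Matrix V V ℝ} {X : Finset V} {u v : V}

theorem mem_iff_edgeClass (w : V) : w ∈ X ↔
    edgeClass A X u v w = 0 ∨ edgeClass A X u v w = 2 ∨ edgeClass A X u v w = 4 := by
  unfold edgeClass
  split_ifs with h1 <;> simp [h1]

theorem edgeClass_eq_zero (hu : u ∈ X) {w : V} : edgeClass A X u v w = 0 ↔ w = u := by
  unfold edgeClass
  split_ifs <;> simp_all <;> rintro rfl <;> contradiction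

theorem edgeClass_eq_one (hv : v ∉ X) {w : V} : edgeClass A X u v w = 1 ↔ w = v := by
  unfold edgeClass
  split_ifs <;> simp_all <;> rintro rfl <;> contradiction

namespace IsUnbalancedC4Free

/-- Only classes 2 and 3 need the 4-cycle condition: there w and z are positive neighbours of v and
u, so an edge wz of sign 1 would make u, v, w, z a negative 4-cycle. -/
theorem le_blockMatrix_of_mem (h : IsUnbalancedC4Free A X) (huv : A u v < 0) {w z : V}
    (hw : w ∈ X) (hz : z ∉ X) :
    A w z ≤ blockMatrix (edgeClass A X u v w) (edgeClass A X u v z) := by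
  unfold edgeClass
  rw [if_pos hw, if_neg hz]
  have huv' := h.eq_neg_one_of_neg huv
  split_ifs with h1 h2 h3 h4 h5 h6 h7 h8
  · subst h1; subst h2; simp [blockMatrix, huv']
  · subst h1; simp [blockMatrix, h3]
  · subst h1; simpa [blockMatrix] using h.le_zero_of_ne_one h3
  · subst h5; simp [blockMatrix, h4]
  · have := h.fourCycle u w v z
    rw [huv', h4, h6] at this
    simp [blockMatrix]
    linarith
  · simpa [blockMatrix] using h.le_one w z
  · subst h7; simpa [blockMatrix] using h.le_zero_of_ne_one h4
  · simpa [blockMatrix] using h.le_one w z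
  · simpa [blockMatrix] using h.le_one w z

theorem le_blockMatrix (h : IsUnbalancedC4Free A X) (huv : A u v < 0) (w z : V) :
    A w z ≤ blockMatrix (edgeClass A X u v w) (edgeClass A X u v z) := by
  by_cases hw : w ∈ X <;> by_cases hz : z ∈ X
  · rw [h.eq_zero_of_same_side (by tauto)]
    rcases (mem_iff_edgeClass (A := A) (u := u) (v := v) w).1 hw with h1 | h1 | h1 <;>
    rcases (mem_iff_edgeClass (A := A) (u := u) (v := v) z).1 hz with h2 | h2 | h2 <;>
    simp [h1, h2, blockMatrix]
  · exact h.le_blockMatrix_of_mem huv hw hz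
  · rw [h.comm, blockMatrix_comm]
    exact h.le_blockMatrix_of_mem huv hz hw
  · rw [h.eq_zero_of_same_side (by tauto)]
    unfold edgeClass
    rw [if_neg hw, if_neg hz]
    split_ifs <;> simp [blockMatrix]

/-- Outside of the negative edge itself, some class is at least `2`. -/
theorem two_le_of_ne (h : IsUnbalancedC4Free A X) (huv : A u v < 0) (hu : u ∈ X) (hv : v ∉ X)
    {w z : V} (hne : A w z ≠ blockMatrix (edgeClass A X u v w) (edgeClass A X u v z)) :
    2 ≤ edgeClass A X u v w ∨ 2 ≤ edgeClass A X u v z := by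
  by_contra! hlt
  have hcases : ∀ t, edgeClass A X u v t < 2 → t = u ∨ t = v := fun t ht => by
    rw [← edgeClass_eq_zero (A := A) (v := v) hu, ← edgeClass_eq_one (A := A) (u := u) hv]
    omega
  have hku := (edgeClass_eq_zero (A := A) (v := v) hu).2 rfl
  have hkv := (edgeClass_eq_one (A := A) (u := u) hv).2 rfl
  have huv' := h.eq_neg_one_of_neg huv
  apply hne
  rcases hcases w hlt.1 with rfl | rfl <;> rcases hcases z hlt.2 with rfl | rfl
  · simp [hku, blockMatrix, h.eq_zero_of_same_side Iff.rfl]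
  · simp [hku, hkv, blockMatrix, huv']
  · simp [hku, hkv, blockMatrix, h.comm w z, huv']
  · simp [hkv, blockMatrix, h.eq_zero_of_same_side Iff.rfl]

theorem exists_edgeClass_two (h : IsUnbalancedC4Free A X) (hv : v ∉ X) (huv : A u v < 0)
    (hpos : ∃ w, 0 < A v w) : ∃ w, edgeClass A X u v w = 2 := by
  obtain ⟨w, hw⟩ := hpos
  have hw1 := h.eq_one_of_pos hw
  have hwX : w ∈ X := by have := h.bipartite v w hw.ne'; tauto
  rw [h.comm] at hw1
  refine ⟨w, ?_⟩
  have hwu : w ≠ u := by rintro rfl; rw [hw1] at huv; norm_num at huv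
  simp [edgeClass, hwX, hwu, hw1]

theorem exists_edgeClass_three (h : IsUnbalancedC4Free A X) (hu : u ∈ X) (huv : A u v < 0)
    (hpos : ∃ w, 0 < A u w) : ∃ w, edgeClass A X u v w = 3 := by
  obtain ⟨w, hw⟩ := hpos
  have hw1 := h.eq_one_of_pos hw
  have hwX : w ∉ X := by have := h.bipartite u w hw.ne'; tauto
  refine ⟨w, ?_⟩
  have hwu : w ≠ v := by rintro rfl; rw [hw1] at huv; norm_num at huv
  simp [edgeClass, hwX, hwu, hw1]

theorem exists_edgeClass_four (h : IsUnbalancedC4Free A X) (hv : v ∉ X) (huv : A u v < 0) :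
    ∃ w, edgeClass A X u v w = 4 := by
  obtain ⟨w, hw, hw0⟩ := h.exists_eq_zero v
  rw [h.comm] at hw0
  refine ⟨w, ?_⟩
  have hwu : w ≠ u := by rintro rfl; rw [hw0] at huv; norm_num at huv
  simp [edgeClass, hw.2 hv, hwu, hw0]

theorem exists_edgeClass_five (h : IsUnbalancedC4Free A X) (hu : u ∈ X) (huv : A u v < 0) :
    ∃ w, edgeClass A X u v w = 5 := by
  obtain ⟨w, hw, hw0⟩ := h.exists_eq_zero u
  have hwX : w ∉ X := by tauto
  refine ⟨w, ?_⟩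
  have hwu : w ≠ v := by rintro rfl; rw [hw0] at huv; norm_num at huv
  simp [edgeClass, hwX, hwu, hw0]

variable [Fintype V]

theorem partSize_zero (hu : u ∈ X) : partSize (edgeClass A X u v) 0 = 1 := by
  rw [partSize, Finset.card_eq_one]
  exact ⟨u, by ext w; simp [edgeClass_eq_zero hu]⟩

theorem partSize_one (hv : v ∉ X) : partSize (edgeClass A X u v) 1 = 1 := by
  rw [partSize, Finset.card_eq_one]
  exact ⟨v, by ext w; simp [edgeClass_eq_one hv]⟩

theorem one_le_partSize {k : V → Fin 6} {c : Fin 6} (h : ∃ w, k w = c) : 1 ≤ partSize k c := by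
  obtain ⟨w, hw⟩ := h
  exact Finset.card_pos.2 ⟨w, by simpa using hw⟩

theorem card_eq_partSize {X : Finset V} {k : V → Fin 6} {i j l : Fin 6} (hij : i ≠ j)
    (hil : i ≠ l) (hjl : j ≠ l) (hk : ∀ w, w ∈ X ↔ k w = i ∨ k w = j ∨ k w = l) :
    X.card = partSize k i + partSize k j + partSize k l := by
  classical
  have hf : ∀ c, (c = i ∨ c = j ∨ c = l) → (X.filter fun w => k w = c).card = partSize k c := by
    rintro c hc
    rw [partSize]
    congr 1
    ext w
    simp only [mem_filter, hk, mem_univ, true_and, and_iff_right_iff_imp]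
    rintro rfl
    exact hc
  rw [Finset.card_eq_sum_card_fiberwise (f := k) (t := {i, j, l}),
    Finset.sum_insert (by simp [hij, hil]), Finset.sum_insert (by simp [hjl]),
    Finset.sum_singleton, hf i (by simp), hf j (by simp), hf l (by simp), add_assoc]
  intro w hw
  simpa using (hk w).1 hw

end IsUnbalancedC4Free

end EdgeClass

/-! ### The bound and its equality case for matrices -/

section Extremal

variable {V : Type*} [Fintype V] [DecidableEq V] {A : Matrix V V ℝ} {X : Finset V}

theorem isHermitian_submatrix_blockMatrix {V : Type*} (k : V → Fin 6) :
    (blockMatrix.submatrix k k).IsHermitian := by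
  ext u v
  simp [blockMatrix_comm (k u)]

theorem IsUnbalancedC4Free.sq_le_of_nonneg (h : IsUnbalancedC4Free A X) {σ : ℝ} (hσ : 0 < σ)
    {x : V → ℝ} (hx : x ≠ 0) (hAx : A *ᵥ x = σ • x) (hx0 : ∀ v, 0 ≤ x v)
    (hpos : ∀ u v, A u v < 0 → ∃ w, 0 < A u w) :
    σ ^ 2 ≤ extremalSq X.card Xᶜ.card ∧ (σ ^ 2 = extremalSq X.card Xᶜ.card →
      ∃ k : V → Fin 6, A = blockMatrix.submatrix k k ∧ (∀ w, w ∈ X ↔ k w = 0 ∨ k w = 2 ∨ k w = 4) ∧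
        partSize k 0 = 1 ∧ partSize k 1 = 1 ∧ partSize k 2 = 1 ∧ partSize k 3 = 1) := by
  obtain ⟨u, v, huv, hu, hv⟩ : ∃ u v, A u v < 0 ∧ u ∈ X ∧ v ∉ X := by
    obtain ⟨u, v, huv⟩ := h.unbalanced fun _ => 1
    have huv : A u v < 0 := by simpa [switchMatrix_apply] using huv
    have hb := h.bipartite u v huv.ne
    by_cases hu : u ∈ X
    · exact ⟨u, v, huv, hu, hb.1 hu⟩
    · exact ⟨v, u, by rwa [h.comm], by tauto, hu⟩
  have : Nonempty V := ⟨u⟩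
  set k := edgeClass A X u v with hk
  have hkX : ∀ w, w ∈ X ↔ k w = 0 ∨ k w = 2 ∨ k w = 4 := mem_iff_edgeClass
  have hkY : ∀ w, w ∈ Xᶜ ↔ k w = 1 ∨ k w = 3 ∨ k w = 5 := fun w => by
    rw [mem_compl, hkX]
    generalize k w = c
    fin_cases c <;> simp
  have hle := h.le_blockMatrix huv
  rw [← hk] at hle
  have n0 : partSize k 0 = 1 := IsUnbalancedC4Free.partSize_zero hu
  have n1 : partSize k 1 = 1 := IsUnbalancedC4Free.partSize_one hv
  have ex0 : ∃ w, k w = 0 := ⟨u, (edgeClass_eq_zero hu).2 rfl⟩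
  have ex1 : ∃ w, k w = 1 := ⟨v, (edgeClass_eq_one hv).2 rfl⟩
  have ex2 := h.exists_edgeClass_two hv huv (hpos v u (by rwa [h.comm]))
  have ex3 := h.exists_edgeClass_three hu huv (hpos u v huv)
  have ex4 := h.exists_edgeClass_four hv huv
  have ex5 := h.exists_edgeClass_five hu huv
  rw [← hk] at ex2 ex3 ex4 ex5
  have n2 : (1 : ℝ) ≤ partSize k 2 := by
    exact_mod_cast IsUnbalancedC4Free.one_le_partSize ex2
  have n3 : (1 : ℝ) ≤ partSize k 3 := by
    exact_mod_cast IsUnbalancedC4Free.one_le_partSize ex3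
  have n4 : (1 : ℝ) ≤ partSize k 4 := by
    exact_mod_cast IsUnbalancedC4Free.one_le_partSize ex4
  have n5 : (1 : ℝ) ≤ partSize k 5 := by
    exact_mod_cast IsUnbalancedC4Free.one_le_partSize ex5
  have hcX : (X.card : ℝ) = 1 + partSize k 2 + partSize k 4 := by
    rw [IsUnbalancedC4Free.card_eq_partSize (by decide) (by decide) (by decide) hkX, n0]
    push_cast; ring
  have hcY : (Xᶜ.card : ℝ) = 1 + partSize k 3 + partSize k 5 := by
    rw [IsUnbalancedC4Free.card_eq_partSize (by decide) (by decide) (by decide) hkY, n1]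
    push_cast; ring
  rw [hcX, hcY]
  obtain ⟨μ, z, hz, hBz, hmax, heqv⟩ :=
    exists_max_eigenvalue (isHermitian_submatrix_blockMatrix k)
  have hxx : 0 < x ⬝ᵥ x := lt_of_le_of_ne (Finset.sum_nonneg fun i _ => mul_self_nonneg (x i))
    (fun h0 => hx (dotProduct_self_eq_zero.1 h0.symm))
  have hmono : x ⬝ᵥ A *ᵥ x ≤ x ⬝ᵥ blockMatrix.submatrix k k *ᵥ x := by
    refine Finset.sum_le_sum fun w _ => mul_le_mul_of_nonneg_left ?_ (hx0 w)
    exact Finset.sum_le_sum fun t _ => mul_le_mul_of_nonneg_right (hle w t) (hx0 t)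
  rw [hAx, dotProduct_smul, smul_eq_mul] at hmono
  have hσμ : σ ≤ μ := le_of_mul_le_mul_right (hmono.trans (hmax x)) hxx
  have hμ : 0 < μ := hσ.trans_le hσμ
  obtain ⟨y, hy, -, hyE⟩ := exists_isBlockEigen n0 n1 hμ hz hBz
  have hμle := (hyE.sq_le hμ hy n2 n3 n5 n4).1
  refine ⟨le_trans (by gcongr) hμle, fun heq => ?_⟩
  have hσμ' : μ = σ := by
    refine le_antisymm ?_ hσμ
    rw [← heq] at hμle
    exact (sq_le_sq₀ hμ.le hσ.le).1 hμle
  subst hσμ'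
  -- As μ = σ, x attains the maximal Rayleigh quotient of the blow-up, hence is an eigenvector of
  -- it.
  have hBx := heqv x (le_antisymm (hmax x) hmono)
  obtain ⟨y, hy, hxy, hyE⟩ := exists_isBlockEigen n0 n1 hμ hx hBx
  have hy0 : ∀ i, 0 ≤ y i := by
    have hex : ∀ i, ∃ w, k w = i := by
      intro i
      fin_cases i
      exacts [ex0, ex1, ex2, ex3, ex4, ex5]
    intro i
    obtain ⟨w, rfl⟩ := hex i
    rw [← hxy]
    exact hx0 w
  obtain ⟨ha, hb⟩ := hyE.eq_one_of_sq_eq hμ hy hy0 n2 n3 n5 n4 heq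
  -- The two matrices agree on x ≥ 0 and are entrywise comparable, so they differ only in columns
  -- where x vanishes.
  have hzero : ∀ w t, A w t ≠ blockMatrix (k w) (k t) → x t = 0 := by
    intro w t hne
    have h1 := congrFun (hBx.trans hAx.symm) w
    simp only [mulVec, dotProduct, submatrix_apply] at h1
    have h2 := (Finset.sum_eq_sum_iff_of_le fun t _ =>
      mul_le_mul_of_nonneg_right (hle w t) (hx0 t)).1 h1.symm t (mem_univ t)
    by_contra h0
    exact hne (mul_right_cancel₀ h0 h2)
  refine ⟨k, ?_, hkX, n0, n1, by exact_mod_cast ha, by exact_mod_cast hb⟩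
  ext w t
  by_contra hne
  -- By symmetry x vanishes at both w and t, but one of them lies in a class where x is positive.
  have ht := hzero w t hne
  have hw := hzero t w (by rwa [h.comm, blockMatrix_comm])
  rw [hxy] at ht hw
  rcases h.two_le_of_ne huv hu hv hne with h2 | h2
  · exact (hyE.pos_of_two_le hμ n5 n4 hy0 hy _ h2).ne' hw
  · exact (hyE.pos_of_two_le hμ n5 n4 hy0 hy _ h2).ne' ht

theorem IsUnbalancedC4Free.sq_le (h : IsUnbalancedC4Free A X) {σ : ℝ} (hσ : 0 < σ)
    {x : V → ℝ} (hx : x ≠ 0) (hAx : A *ᵥ x = σ • x) :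
    σ ^ 2 ≤ extremalSq X.card Xᶜ.card ∧ (σ ^ 2 = extremalSq X.card Xᶜ.card →
      ∃ (τ : V → ℤˣ) (k : V → Fin 6), switchMatrix A τ = blockMatrix.submatrix k k ∧
        (∀ w, w ∈ X ↔ k w = 0 ∨ k w = 2 ∨ k w = 4) ∧
        partSize k 0 = 1 ∧ partSize k 1 = 1 ∧ partSize k 2 = 1 ∧ partSize k 3 = 1) := by
  obtain ⟨τ, hτ, hpos⟩ := h.exists_switch hσ hAx
  obtain ⟨h1, h2⟩ := (h.switch τ).sq_le_of_nonneg hσ (x := fun v => ((τ v : ℤ) : ℝ) * x v)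
    (fun h0 => hx (by
      ext v
      have := congrFun h0 v
      simpa using this)) (mulVec_switch hAx τ) hτ hpos
  exact ⟨h1, fun heq => ⟨τ, h2 heq⟩⟩

end Extremal

/-! ### Γ_{r,s} as a blow-up attaining the bound -/

section Gamma

/-- The classes of the vertices of `Γ_{r,s}` in `blockMatrix`. -/
def gammaClass (r s : ℕ) : Fin r ⊕ Fin s → Fin 6 :=
  Sum.elim (fun i => if i.val = 0 then 0 else if i.val = 1 then 2 else 4)
    (fun j => if j.val = 0 then 1 else if j.val = 1 then 3 else 5)

variable {r s : ℕ}

theorem gamma_adjMatrix_inl_inr (i : Fin r) (j : Fin s) :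
    (gamma r s).adjMatrix (Sum.inl i) (Sum.inr j) =
      blockMatrix (gammaClass r s (Sum.inl i)) (gammaClass r s (Sum.inr j)) := by
  have hadj : (gamma r s).graph.Adj (Sum.inl i) (Sum.inr j) ↔
      ((1 ≤ i.val ∧ 1 ≤ j.val ∧ ¬ (i.val = 1 ∧ j.val = 1)) ∨
      (i.val = 0 ∧ j.val = 1) ∨ (i.val = 0 ∧ j.val = 0) ∨ (i.val = 1 ∧ j.val = 0)) := by
    simp [gamma, gammaGraph, SimpleGraph.fromRel_adj]
  by_cases h : (gamma r s).graph.Adj (Sum.inl i) (Sum.inr j)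
  · rw [adjMatrix_of_adj _ h]
    rw [hadj] at h
    by_cases h0 : i.val = 0 ∧ j.val = 0
    · have : ∃ (i' : Fin r) (j' : Fin s), i'.val = 0 ∧ j'.val = 0 ∧
          s(Sum.inl i, Sum.inr j) = s(Sum.inl i', Sum.inr j') := ⟨i, j, h0.1, h0.2, rfl⟩
      simp only [gamma, if_pos this]
      simp [gammaClass, h0, blockMatrix]
    · have : ¬ ∃ (i' : Fin r) (j' : Fin s), i'.val = 0 ∧ j'.val = 0 ∧
          s(Sum.inl i, Sum.inr j) = s(Sum.inl i', Sum.inr j') := by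
        rintro ⟨i', j', hi, hj, he⟩
        simp at he
        exact h0 (by rw [he.1, he.2]; exact ⟨hi, hj⟩)
      simp only [gamma, if_neg this]
      simp only [gammaClass, Sum.elim_inl, Sum.elim_inr]
      split_ifs <;> simp [blockMatrix] <;> omega
  · rw [adjMatrix_of_not_adj _ h]
    rw [hadj] at h
    simp only [gammaClass, Sum.elim_inl, Sum.elim_inr]
    split_ifs <;> simp [blockMatrix] <;> omega

theorem gamma_adjMatrix :
    (gamma r s).adjMatrix = blockMatrix.submatrix (gammaClass r s) (gammaClass r s) := by
  ext a b
  rw [submatrix_apply]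
  rcases a with i | j <;> rcases b with i' | j'
  · rw [adjMatrix_of_not_adj _ (by simp [gamma, gammaGraph, SimpleGraph.fromRel_adj])]
    simp only [gammaClass, Sum.elim_inl]
    split_ifs <;> simp [blockMatrix]
  · exact gamma_adjMatrix_inl_inr i j'
  · rw [adjMatrix_comm, blockMatrix_comm]
    exact gamma_adjMatrix_inl_inr i' j
  · rw [adjMatrix_of_not_adj _ (by simp [gamma, gammaGraph, SimpleGraph.fromRel_adj])]
    simp only [gammaClass, Sum.elim_inr]
    split_ifs <;> simp [blockMatrix]

theorem partSize_gammaClass (hr : 3 ≤ r) (hs : 3 ≤ s) :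
    partSize (gammaClass r s) 0 = 1 ∧ partSize (gammaClass r s) 1 = 1 ∧
      partSize (gammaClass r s) 2 = 1 ∧ partSize (gammaClass r s) 3 = 1 ∧
      partSize (gammaClass r s) 4 = r - 2 ∧ partSize (gammaClass r s) 5 = s - 2 := by
  have h0 : partSize (gammaClass r s) 0 = 1 := Finset.card_eq_one.2
    ⟨Sum.inl ⟨0, by omega⟩, by
      ext a
      rcases a with a | a <;> by_cases a0 : a.val = 0 <;> by_cases a1 : a.val = 1 <;>
        simp [gammaClass, Fin.ext_iff, a0, a1, -Fin.val_eq_zero_iff]⟩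
  have h1 : partSize (gammaClass r s) 1 = 1 := Finset.card_eq_one.2
    ⟨Sum.inr ⟨0, by omega⟩, by
      ext a
      rcases a with a | a <;> by_cases a0 : a.val = 0 <;> by_cases a1 : a.val = 1 <;>
        simp [gammaClass, Fin.ext_iff, a0, a1, -Fin.val_eq_zero_iff]⟩
  have h2 : partSize (gammaClass r s) 2 = 1 := Finset.card_eq_one.2
    ⟨Sum.inl ⟨1, by omega⟩, by
      ext a
      rcases a with a | a <;> by_cases a0 : a.val = 0 <;> by_cases a1 : a.val = 1 <;>
        simp [gammaClass, Fin.ext_iff, a0, a1, -Fin.val_eq_zero_iff]⟩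
  have h3 : partSize (gammaClass r s) 3 = 1 := Finset.card_eq_one.2
    ⟨Sum.inr ⟨1, by omega⟩, by
      ext a
      rcases a with a | a <;> by_cases a0 : a.val = 0 <;> by_cases a1 : a.val = 1 <;>
        simp [gammaClass, Fin.ext_iff, a0, a1, -Fin.val_eq_zero_iff]⟩
  have hr' := IsUnbalancedC4Free.card_eq_partSize (X := univ.map Function.Embedding.inl)
    (k := gammaClass r s) (i := 0) (j := 2) (l := 4) (by decide) (by decide) (by decide) (by
      intro w
      rcases w with w | w <;> by_cases w0 : w.val = 0 <;> by_cases w1 : w.val = 1 <;>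
        simp [gammaClass, w0, w1])
  have hs' := IsUnbalancedC4Free.card_eq_partSize (X := univ.map Function.Embedding.inr)
    (k := gammaClass r s) (i := 1) (j := 3) (l := 5) (by decide) (by decide) (by decide) (by
      intro w
      rcases w with w | w <;> by_cases w0 : w.val = 0 <;> by_cases w1 : w.val = 1 <;>
        simp [gammaClass, w0, w1])
  simp only [card_map, card_univ, Fintype.card_fin] at hr' hs'
  exact ⟨h0, h1, h2, h3, by omega, by omega⟩

/-- `Γ_{r,s}` has the eigenvalue `√(extremalSq r s)`. -/
theorem exists_eigenvector_gamma (hr : 3 ≤ r) (hs : 3 ≤ s) :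
    ∃ z : Fin r ⊕ Fin s → ℝ, z ≠ 0 ∧
      (gamma r s).adjMatrix *ᵥ z = Real.sqrt (extremalSq r s) • z := by
  have hr' : (3 : ℝ) ≤ r := by exact_mod_cast hr
  have hs' : (3 : ℝ) ≤ s := by exact_mod_cast hs
  obtain ⟨y, hy, h4, hyE⟩ := exists_isBlockEigen_extremal hr' hs'
  obtain ⟨n0, n1, n2, n3, n4, n5⟩ := partSize_gammaClass hr hs
  refine ⟨fun a => y (gammaClass r s a), fun h0 => hy ?_, ?_⟩
  · have hμ : 0 < Real.sqrt (extremalSq r s) :=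
      Real.sqrt_pos.2 (by linarith [three_le_extremalSq hr' hs'])
    refine hyE.eq_zero hμ ?_ ?_
    · simpa [gammaClass] using congrFun h0 (Sum.inl ⟨0, by omega⟩)
    · simpa [gammaClass] using congrFun h0 (Sum.inl ⟨1, by omega⟩)
  · rw [gamma_adjMatrix]
    ext a
    simp only [mulVec, dotProduct, submatrix_apply, Pi.smul_apply, smul_eq_mul]
    rw [sum_comp_part (gammaClass r s) fun c => blockMatrix (gammaClass r s a) c * y c]
    have e4 : ((r - 2 : ℕ) : ℝ) = r - 2 := by push_cast [show 2 ≤ r by omega]; ring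
    have e5 : ((s - 2 : ℕ) : ℝ) = s - 2 := by push_cast [show 2 ≤ s by omega]; ring
    have := hyE.eq0
    have := hyE.eq1
    have := hyE.eq2
    have := hyE.eq3
    have := hyE.eq4
    have := hyE.eq5
    generalize gammaClass r s a = c
    simp only [Fin.sum_univ_six, n0, n1, n2, n3, n4, n5, e4, e5]
    fin_cases c <;> simp [blockMatrix] <;> linarith

end Gamma

/-! ### Back to signed graphs -/

section Main

variable {V : Type*} {Γ : SignedGraph V} {r s : ℕ}

theorem isUnbalancedC4Free_adjMatrix (hunb : Γ.IsUnbalanced) (hC4 : ¬ Γ.HasNegativeC4)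
    {X : Finset V} (hX : ∀ u v, Γ.graph.Adj u v → (u ∈ X ↔ v ∉ X)) :
    IsUnbalancedC4Free Γ.adjMatrix X where
  comm := Γ.adjMatrix_comm
  values := Γ.adjMatrix_values
  bipartite u v h := hX u v (Γ.adjMatrix_ne_zero_iff.1 h)
  fourCycle := Γ.fourCycle_prod_nonneg hC4
  unbalanced := Γ.exists_neg_of_isUnbalanced hunb

variable [Fintype V] [DecidableEq V]

theorem IsBipartiteOfSizes.exists_finset (h : Γ.IsBipartiteOfSizes r s) :
    ∃ X : Finset V, X.card = r ∧ Xᶜ.card = s ∧ ∀ u v, Γ.graph.Adj u v → (u ∈ X ↔ v ∉ X) := by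
  classical
  obtain ⟨X, Y, hXY, hb, hX, hY⟩ := h
  have hYX : Y = Xᶜ := (IsCompl.of_eq hb.disjoint.eq_bot hXY).compl_eq.symm
  subst hYX
  refine ⟨X.toFinset, ?_, ?_, fun u v huv => ?_⟩
  · rw [Set.encard_eq_coe_toFinset_card] at hX
    exact_mod_cast hX
  · rw [Set.encard_eq_coe_toFinset_card, Set.toFinset_compl] at hY
    exact_mod_cast hY
  · have := hb.mem_of_adj huv
    simp only [Set.mem_compl_iff, Set.mem_toFinset] at this ⊢
    tauto

theorem SwitchingIsomorphic.sqrt_extremalSq_le_rho (hr : 3 ≤ r) (hs : 3 ≤ s)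
    (h : Γ.SwitchingIsomorphic (gamma r s)) : Real.sqrt (extremalSq r s) ≤ Γ.rho := by
  obtain ⟨τ, e, he⟩ := (Γ.switchingIsomorphic_iff _).1 h
  obtain ⟨z, hz, hAz⟩ := exists_eigenvector_gamma hr hs
  refine (le_abs_self _).trans (Γ.abs_le_rho (x := fun v => ((τ v : ℤ) : ℝ) * z (e.symm v))
    (fun h0 => hz ?_) ?_)
  · ext i
    simpa using congrFun h0 (e i)
  · ext v
    obtain ⟨i, rfl⟩ := e.surjective v
    have hi := congrFun hAz i
    simp only [mulVec, dotProduct, Pi.smul_apply, smul_eq_mul, ← he] at hi ⊢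
    rw [← e.sum_comp]
    simp only [Equiv.symm_apply_apply]
    rw [mul_left_comm, ← hi, Finset.mul_sum]
    refine Finset.sum_congr rfl fun j _ => ?_
    linear_combination -(Γ.adjMatrix (e i) (e j) * ((τ (e j) : ℤ) : ℝ) * z j) *
      unit_mul_self (τ (e i))

theorem rho_le_and_eq_iff (hr : 3 ≤ r) (hs : 3 ≤ s) (hbip : Γ.IsBipartiteOfSizes r s)
    (hunb : Γ.IsUnbalanced) (hC4 : ¬ Γ.HasNegativeC4) :
    Γ.rho ≤ Real.sqrt (extremalSq r s) ∧
      (Γ.rho = Real.sqrt (extremalSq r s) ↔ Γ.SwitchingIsomorphic (gamma r s)) := by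
  obtain ⟨X, hXr, hXs, hX⟩ := hbip.exists_finset
  have hA := isUnbalancedC4Free_adjMatrix hunb hC4 hX
  have : Nonempty V := ⟨hunb.choose⟩
  have hθ : 3 ≤ extremalSq r s :=
    three_le_extremalSq (by exact_mod_cast hr) (by exact_mod_cast hs)
  obtain ⟨x, hx, hAx⟩ := Γ.exists_eigenvector_rho X (by simpa using hX)
  have h0 : 0 ≤ Γ.rho := ENNReal.toReal_nonneg
  rcases h0.eq_or_lt with h0 | h0
  -- ρ = 0 is set apart because `exists_switch` and the block equations need a positive eigenvalue.
  · have hlt : Γ.rho < Real.sqrt (extremalSq r s) := by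
      rw [← h0]; exact Real.sqrt_pos.2 (by linarith)
    exact ⟨hlt.le, fun h => absurd h hlt.ne, fun h =>
      absurd (h.sqrt_extremalSq_le_rho hr hs) (not_le.2 hlt)⟩
  obtain ⟨hle, heq⟩ := hA.sq_le h0 hx hAx
  rw [hXr, hXs] at hle heq
  have hle' : Γ.rho ≤ Real.sqrt (extremalSq r s) := Real.le_sqrt_of_sq_le hle
  refine ⟨hle', fun h => ?_, fun h => le_antisymm hle' (h.sqrt_extremalSq_le_rho hr hs)⟩
  obtain ⟨τ, k, hk, hkX, n0, n1, n2, n3⟩ := heq (by rw [h, Real.sq_sqrt (by linarith)])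
  have hkY : ∀ w, w ∈ Xᶜ ↔ k w = 1 ∨ k w = 3 ∨ k w = 5 := fun w => by
    rw [mem_compl, hkX]
    generalize k w = c
    fin_cases c <;> simp
  have hcX := IsUnbalancedC4Free.card_eq_partSize (by decide) (by decide) (by decide) hkX
  have hcY := IsUnbalancedC4Free.card_eq_partSize (by decide) (by decide) (by decide) hkY
  obtain ⟨m0, m1, m2, m3, m4, m5⟩ := partSize_gammaClass hr hs
  -- The sizes of parts 4 and 5 are forced by |X| = r and |Xᶜ| = s, so the blow-up is that of
  -- Γ_{r,s} up to relabelling.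
  obtain ⟨e, he⟩ := exists_equiv_of_partSize_eq (k := k) (l := gammaClass r s) (by
    intro c
    fin_cases c <;> simp <;> omega)
  refine (Γ.switchingIsomorphic_iff _).2 ⟨τ, e, fun i j => ?_⟩
  rw [← switchMatrix_apply, hk, gamma_adjMatrix, submatrix_apply, submatrix_apply, he, he]

end Main

end SignedGraph

theorem theorem1 {V : Type*} [Fintype V] [DecidableEq V] (r s : ℕ) (hr : 3 ≤ r) (hrs : r ≤ s)
    (Γ : SignedGraph V) (hbip : Γ.IsBipartiteOfSizes r s) (hunb : Γ.IsUnbalanced)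
    (hC4 : ¬ Γ.HasNegativeC4) :
    Γ.rho ≤ Real.sqrt (1 / 2 * ((((r : ℝ) - 1) * ((s : ℝ) - 1) + 2) +
        Real.sqrt ((((r : ℝ) - 1) * ((s : ℝ) - 1) + 2) ^ 2 -
          4 * (2 * (r : ℝ) - 3) * (2 * (s : ℝ) - 3)))) ∧
      (Γ.rho = Real.sqrt (1 / 2 * ((((r : ℝ) - 1) * ((s : ℝ) - 1) + 2) +
          Real.sqrt ((((r : ℝ) - 1) * ((s : ℝ) - 1) + 2) ^ 2 -
            4 * (2 * (r : ℝ) - 3) * (2 * (s : ℝ) - 3)))) ↔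
        Γ.SwitchingIsomorphic (SignedGraph.gamma r s)) :=
  SignedGraph.rho_le_and_eq_iff hr (hr.trans hrs) hbip hunb hC4
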